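/- A searcher starts at the origin of the real line and looks for a target at unknown distance $D\ge\lambda$ from the origin, on the left or on the right, where $\lambda>0$ is known. A \emph{search strategy} is a sequence $(x_i,r_i)_{i\ge 1}$ with $x_i\ge 0$ and $r_i\in\{\text{left},\text{right}\}$ such that $\sup_{r_i=\text{left}}x_i=\sup_{r_i=\text{right}}x_i=\infty$: at step $i$ the searcher walks a distance $x_i$ away from the origin on the ray $r_i$ and, if the target is not met, walks back to the origin. Walking a distance $x$ away from the origin costs $\alpha_1x+\beta_1$ and walking a distance $y$ back to the origin costs $\alpha_2y+\beta_2$, where $\alpha_1,\alpha_2,\beta_1,\beta_2\ge 0$ and $\alpha_1+\alpha_2>0$. A target at distance $D$ on ray $r$ is found at the first step $j$ with $r_j=r$ and $x_j\ge D$, at total cost $\sum_{i=1}^{j-1}\big((\alpha_1+\alpha_2)x_i+\beta_1+\beta_2\big)+\alpha_1D+\beta_1$. The \emph{competitive cost} of a strategy is the supremum of this total cost divided by $D$, over both rays and all $D\ge\lambda$; a strategy is \emph{optimal} if its competitive cost is minimal among all search strategies. A sequence $(x_i)_{i\ge1}$ is used as a strategy by visiting the two rays alternately, starting with either one. (1)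 If $\frac{3\beta_1+2\beta_2}{2(\alpha_1+\alpha_2)\lambda}\le 1$, the strategy $$x_i=\left(\left(\left(1-\frac{3\beta_1+2\beta_2}{2(\alpha_1+\alpha_2)\lambda}\right)i+\left(1+\frac{\beta_1+\beta_2}{(\alpha_1+\alpha_2)\lambda}\right)\right)2^i-\frac{\beta_1+\beta_2}{(\alpha_1+\alpha_2)\lambda}\right)\lambda$$ is optimal and has competitive cost $5\alpha_1+4\alpha_2$. (2) If $\frac{3\beta_1+2\beta_2}{2(\alpha_1+\alpha_2)\lambda}\ge 1$, the strategy $$x_i=\left(\left(1+\frac{\beta_1+\beta_2}{(\alpha_1+\alpha_2)\lambda}\right)\Phi^i-\frac{\beta_1+\beta_2}{(\alpha_1+\alpha_2)\lambda}\right)\lambda,$$ where $$\Phi=1+\left(\frac{2\beta_1+\beta_2-(\alpha_1+\alpha_2)\lambda+\sqrt{(2\beta_1+\beta_2)^2-\beta_2^2+(\beta_2+(\alpha_1+\alpha_2)\lambda)^2}}{2(\alpha_1+\alpha_2)\lambda}\right)^{-1},$$ is optimal and has competitive cost $\frac{(\alpha_1+\alpha_2)x_1+(\beta_1+\beta_2)+(\alpha_1\lambda+\beta_1)}{\lambda}$.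 -/

import Mathlib

/-- The two rays leaving the origin of the line. -/
inductive Ray
  | left
  | right

/-- Walking a distance `x` away from the origin costs `α₁ * x + β₁`;
walking a distance `y` back to the origin costs `α₂ * y + β₂`. -/
structure CostModel where
  α₁ : ℝ
  α₂ : ℝ
  β₁ : ℝ
  β₂ : ℝ

namespace CostModel

def cost₁ (C : CostModel) (x : ℝ) : ℝ := C.α₁ * x + C.β₁

def cost₂ (C : CostModel) (y : ℝ) : ℝ := C.α₂ * y + C.β₂

end CostModel

/-- The data of a search strategy. Steps are numbered from `0`: the step usually called step `i + 1`
goes to distance `dist i` on the ray `ray i` and, if the target is not found, returns to the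
origin. -/
structure SearchStrategy where
  dist : ℕ → ℝ
  ray : ℕ → Ray

namespace SearchStrategy

/-- Distances are nonnegative, and on each ray they have supremum `∞`. -/
def IsValid (S : SearchStrategy) : Prop :=
  (∀ i, 0 ≤ S.dist i) ∧ ∀ (r : Ray) (M : ℝ), ∃ i, S.ray i = r ∧ M < S.dist i

/-- The two rays are visited alternately. -/
def IsPeriodic (S : SearchStrategy) : Prop :=
  S.ray 0 ≠ S.ray 1 ∧ ∀ i, S.ray (i + 2) = S.ray i

/-- A target on ray `r` at distance `D` is found at step `j`: this is the first step that
goes at least as far as `D` on the ray `r`. -/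
def FindsAt (S : SearchStrategy) (r : Ray) (D : ℝ) (j : ℕ) : Prop :=
  S.ray j = r ∧ D ≤ S.dist j ∧ ∀ i < j, S.ray i = r → S.dist i < D

/-- The total cost paid when a target at distance `D` is found at step `j`. -/
def costAt (C : CostModel) (S : SearchStrategy) (D : ℝ) (j : ℕ) : ℝ :=
  (∑ i ∈ Finset.range j, (C.cost₁ (S.dist i) + C.cost₂ (S.dist i))) + C.cost₁ D

/-- The cost of finding the target on ray `r` at distance `D`, divided by `D`. There is at most one
step at which the target is found; if there is none, the value is `⊤`. -/
noncomputable def ratio (C : CostModel) (S : SearchStrategy) (r : Ray) (D : ℝ) : EReal :=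
  ⨅ (j : ℕ) (_ : S.FindsAt r D j), ((S.costAt C D j / D : ℝ) : EReal)

/-- The competitive cost: the worst case of the ratio over all targets at distance `D ≥ lam`. -/
noncomputable def competitiveCost (C : CostModel) (lam : ℝ) (S : SearchStrategy) : EReal :=
  ⨆ (r : Ray) (D : ℝ) (_ : lam ≤ D), S.ratio C r D

/-- A strategy is optimal if no strategy has a smaller competitive cost. -/
def IsOptimal (C : CostModel) (lam : ℝ) (S : SearchStrategy) : Prop :=
  S.IsValid ∧ ∀ S' : SearchStrategy, S'.IsValid →
    S.competitiveCost C lam ≤ S'.competitiveCost C lam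

end SearchStrategy

namespace CostModel

/-- The parameter `(3β₁ + 2β₂) / (2(α₁ + α₂)λ)` that separates the two regimes. -/
noncomputable def threshold (C : CostModel) (lam : ℝ) : ℝ :=
  (3 * C.β₁ + 2 * C.β₂) / (2 * (C.α₁ + C.α₂) * lam)

/-- The quantity `(β₁ + β₂) / ((α₁ + α₂)λ)`. -/
noncomputable def offset (C : CostModel) (lam : ℝ) : ℝ :=
  (C.β₁ + C.β₂) / ((C.α₁ + C.α₂) * lam)

/-- The `i`-th distance (`i ≥ 1`) of the strategy for small constant costs. -/
noncomputable def xSmall (C : CostModel) (lam : ℝ) (i : ℕ) : ℝ :=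
  (((1 - C.threshold lam) * (i : ℝ) + (1 + C.offset lam)) * 2 ^ i - C.offset lam) * lam

noncomputable def Phi (C : CostModel) (lam : ℝ) : ℝ :=
  1 + ((2 * C.β₁ + C.β₂ - (C.α₁ + C.α₂) * lam
        + Real.sqrt ((2 * C.β₁ + C.β₂) ^ 2 - C.β₂ ^ 2 + (C.β₂ + (C.α₁ + C.α₂) * lam) ^ 2))
      / (2 * (C.α₁ + C.α₂) * lam))⁻¹

/-- The `i`-th distance (`i ≥ 1`) of the strategy for large constant costs. -/
noncomputable def xLarge (C : CostModel) (lam : ℝ) (i : ℕ) : ℝ :=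
  ((1 + C.offset lam) * C.Phi lam ^ i - C.offset lam) * lam

end CostModel

/-! Write `T n` for `prefixCost`, `α = α₁ + α₂`, `β = β₁ + β₂`. Competitive cost `K + α₁` means that
a target at `D` is found at a step `j` with `T j + β₁ ≤ K * D`.

Lower bound: with `κ = K / α`, chaining record steps on alternate rays gives `U'' ≤ κ (U' - U)` for
the shifted costs `U = T + β₁ + κ β`. Hence successive ratios obey `ρ' ≤ κ (1 - 1 / ρ)`. For `κ < 4`
this map has no positive fixed point, so ratios fall until they are negative, which is absurd. For
larger `κ` the smaller fixed point is a barrier: large constant costs force the initial ratio to be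
at most it, and the descent recurs (`not_costBound_of_lt`).

Upper bound: both strategies solve the recurrence with equality, `T (j + 1) + β₁ = K * X j` and `X 0
= lam`. Its characteristic equation is `t ^ 2 = κ (t - 1)`, with double root 2 at `κ = 4` and root
`Φ` at `κ = Φ ^ 2 / (Φ - 1)`. -/

namespace SearchStrategy

/-! ### Prefix costs and cost bounds -/

/-- The total cost of the first `n` steps, including the walks back to the origin. -/
noncomputable def prefixCost (C : CostModel) (S : SearchStrategy) (n : ℕ) : ℝ :=
  ∑ i ∈ Finset.range n, ((C.α₁ + C.α₂) * S.dist i + (C.β₁ + C.β₂))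

theorem costAt_eq (C : CostModel) (S : SearchStrategy) (D : ℝ) (j : ℕ) :
    S.costAt C D j = S.prefixCost C j + C.β₁ + C.α₁ * D := by
  have h : ∀ i, C.cost₁ (S.dist i) + C.cost₂ (S.dist i)
      = (C.α₁ + C.α₂) * S.dist i + (C.β₁ + C.β₂) := fun i => by
    simp only [CostModel.cost₁, CostModel.cost₂]; ring
  simp only [costAt, prefixCost, h]
  simp only [CostModel.cost₁]; ring

theorem prefixCost_zero (C : CostModel) (S : SearchStrategy) : S.prefixCost C 0 = 0 := by
  simp [prefixCost]

theorem prefixCost_succ (C : CostModel) (S : SearchStrategy) (n : ℕ) :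
    S.prefixCost C (n + 1)
      = S.prefixCost C n + ((C.α₁ + C.α₂) * S.dist n + (C.β₁ + C.β₂)) := by
  simp [prefixCost, Finset.sum_range_succ]

theorem prefixCost_mono {C : CostModel} {S : SearchStrategy} (hα : 0 < C.α₁ + C.α₂)
    (hβ₁ : 0 ≤ C.β₁) (hβ₂ : 0 ≤ C.β₂) (hS : ∀ i, 0 ≤ S.dist i) : Monotone (S.prefixCost C) :=
  monotone_nat_of_le_succ fun n => by
    rw [prefixCost_succ]
    have := mul_nonneg hα.le (hS n)
    linarith

/-- A step between `m` and `n` is paid for within the difference of the prefix costs. -/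
theorem step_le_prefixCost_sub {C : CostModel} {S : SearchStrategy} (hα : 0 < C.α₁ + C.α₂)
    (hβ₁ : 0 ≤ C.β₁) (hβ₂ : 0 ≤ C.β₂) (hS : ∀ i, 0 ≤ S.dist i) {m i n : ℕ} (hmi : m ≤ i)
    (hin : i < n) :
    (C.α₁ + C.α₂) * S.dist i + (C.β₁ + C.β₂) ≤ S.prefixCost C n - S.prefixCost C m := by
  have hmono := prefixCost_mono hα hβ₁ hβ₂ hS
  have h1 := hmono hmi
  have h2 := hmono (Nat.succ_le_of_lt hin)
  rw [Nat.succ_eq_add_one, prefixCost_succ] at h2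
  linarith

/-- All targets at distance at least `lam` are found with cost at most `(K + α₁) D`. -/
def CostBound (C : CostModel) (lam : ℝ) (S : SearchStrategy) (K : ℝ) : Prop :=
  ∀ r D, lam ≤ D → ∃ j, S.FindsAt r D j ∧ S.prefixCost C j + C.β₁ ≤ K * D

theorem competitiveCost_le_of_costBound {C : CostModel} {lam : ℝ} {S : SearchStrategy} {K : ℝ}
    (hlam : 0 < lam) (h : CostBound C lam S K) :
    S.competitiveCost C lam ≤ ((K + C.α₁ : ℝ) : EReal) := by
  refine iSup_le fun r => iSup₂_le fun D hD => ?_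
  obtain ⟨j, hj, hle⟩ := h r D hD
  refine iInf₂_le_of_le j hj (EReal.coe_le_coe_iff.2 ?_)
  rw [div_le_iff₀ (hlam.trans_le hD), costAt_eq]
  linarith

theorem exists_costBound_of_competitiveCost_lt {C : CostModel} {lam : ℝ} {S : SearchStrategy}
    {K : ℝ} (hlam : 0 < lam) (h : S.competitiveCost C lam < ((K + C.α₁ : ℝ) : EReal)) :
    ∃ K' < K, CostBound C lam S K' := by
  obtain ⟨c, hc, hcK⟩ := EReal.lt_iff_exists_real_btwn.1 h
  refine ⟨c - C.α₁, by have := EReal.coe_lt_coe_iff.1 hcK; linarith, fun r D hD => ?_⟩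
  have hr : S.ratio C r D < (c : EReal) :=
    lt_of_le_of_lt (le_iSup_of_le r (le_iSup₂_of_le (f := fun D (_ : lam ≤ D) => S.ratio C r D)
      D hD le_rfl)) hc
  obtain ⟨j, hj⟩ := iInf_lt_iff.1 hr
  obtain ⟨hj, hlt⟩ := iInf_lt_iff.1 hj
  refine ⟨j, hj, ?_⟩
  have := EReal.coe_lt_coe_iff.1 hlt
  rw [div_lt_iff₀ (hlam.trans_le hD), costAt_eq] at this
  linarith

/-- The first step beyond distance `D` on the ray `r` starts early. -/
theorem CostBound.exists_first_beyond {C : CostModel} {lam : ℝ} {S : SearchStrategy} {K : ℝ}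
    (h : CostBound C lam S K) (hS : S.IsValid) (r : Ray) {D : ℝ} (hD : lam ≤ D) :
    ∃ n, S.ray n = r ∧ D < S.dist n ∧ (∀ i < n, S.ray i = r → S.dist i ≤ D) ∧
      S.prefixCost C n + C.β₁ ≤ K * D := by
  classical
  have hex := hS.2 r D
  obtain ⟨hn1, hn2⟩ := Nat.find_spec hex
  have hn3 : ∀ i < Nat.find hex, S.ray i = r → S.dist i ≤ D := fun i hi hir =>
    not_lt.1 fun hlt => Nat.find_min hex hi ⟨hir, hlt⟩
  set n := Nat.find hex
  refine ⟨n, hn1, hn2, hn3, ?_⟩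
  -- Targets just beyond `D` are found exactly at step `n`; let their distance decrease to `D`.
  have htend : Filter.Tendsto (fun x => K * x) (nhdsWithin D (Set.Ioi D)) (nhds (K * D)) :=
    ((continuous_const.mul continuous_id).tendsto D).mono_left nhdsWithin_le_nhds
  refine ge_of_tendsto htend ?_
  filter_upwards [Ioc_mem_nhdsGT hn2] with x hx
  obtain ⟨j, ⟨hj1, hj2, hj3⟩, hle⟩ := h r x (hD.trans hx.1.le)
  obtain hlt | rfl | hgt := lt_trichotomy j n
  · exact absurd (hn3 j hlt hj1) (not_le.2 (hx.1.trans_le hj2))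
  · exact hle
  · exact absurd (hj3 n hgt hn1) (not_lt.2 hx.2)

/-! ### Advancing pairs and their recurrence -/

/-- Step `m` goes beyond `lam` and beyond all earlier steps on its ray. -/
def Advances (lam : ℝ) (S : SearchStrategy) (m : ℕ) : Prop :=
  lam ≤ S.dist m ∧ ∀ i < m, S.ray i = S.ray m → S.dist i ≤ S.dist m

/-- Two advancing steps, on different rays. -/
def AdvancePair (lam : ℝ) (S : SearchStrategy) (m n : ℕ) : Prop :=
  m < n ∧ S.ray m ≠ S.ray n ∧ S.Advances lam m ∧ S.Advances lam n

/-- Take the first step beyond `lam` on each ray; even the later one must start within the budget `K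
* lam`. -/
theorem CostBound.exists_advancePair {C : CostModel} {lam : ℝ} {S : SearchStrategy} {K : ℝ}
    (h : CostBound C lam S K) (hS : S.IsValid) :
    ∃ m n, S.AdvancePair lam m n ∧ S.prefixCost C n + C.β₁ ≤ K * lam := by
  obtain ⟨m, hm1, hm2, hm3, hm4⟩ := h.exists_first_beyond hS Ray.left le_rfl
  obtain ⟨n, hn1, hn2, hn3, hn4⟩ := h.exists_first_beyond hS Ray.right le_rfl
  have hm : S.Advances lam m := ⟨hm2.le, fun i hi hir => (hm3 i hi (hir.trans hm1)).trans hm2.le⟩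
  have hn : S.Advances lam n := ⟨hn2.le, fun i hi hir => (hn3 i hi (hir.trans hn1)).trans hn2.le⟩
  have hne : S.ray m ≠ S.ray n := by rw [hm1, hn1]; exact Ray.noConfusion
  obtain hlt | heq | hgt := lt_trichotomy m n
  · exact ⟨m, n, ⟨hlt, hne, hm, hn⟩, hn4⟩
  · exact absurd (by rw [heq]) hne
  · exact ⟨n, m, ⟨hgt, hne.symm, hn, hm⟩, hm4⟩

/-- Let `i` be the farthest step on the ray of `m` before `n`. A target just beyond `dist i` is
missed until some `k > n`, while step `i` was paid for between `m` and `n`, which bounds `dist i`.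
-/
theorem AdvancePair.exists_next {C : CostModel} {lam : ℝ} {S : SearchStrategy} {K : ℝ}
    (hα : 0 < C.α₁ + C.α₂) (hβ₁ : 0 ≤ C.β₁) (hβ₂ : 0 ≤ C.β₂) (h : CostBound C lam S K)
    (hK : 0 ≤ K) (hS : S.IsValid) {m n : ℕ} (hmn : S.AdvancePair lam m n) :
    ∃ k, S.AdvancePair lam n k ∧ S.prefixCost C k + C.β₁ ≤
      K / (C.α₁ + C.α₂) * (S.prefixCost C n - S.prefixCost C m - (C.β₁ + C.β₂)) := by
  classical
  obtain ⟨hlt, hne, hm, hn⟩ := hmn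
  obtain ⟨i, hi, hmax⟩ := ((Finset.Ico m n).filter fun i => S.ray i = S.ray m).exists_max_image
    S.dist ⟨m, by simp [hlt]⟩
  simp only [Finset.mem_filter, Finset.mem_Ico] at hi hmax
  obtain ⟨⟨hmi, hin⟩, hir⟩ := hi
  have hmle : S.dist m ≤ S.dist i := hmax m ⟨⟨le_rfl, hlt⟩, rfl⟩
  have hbefore : ∀ l < n, S.ray l = S.ray m → S.dist l ≤ S.dist i := fun l hl hlr => by
    rcases lt_or_ge l m with hlm | hlm
    · exact (hm.2 l hlm hlr).trans hmle
    · exact hmax l ⟨⟨hlm, hl⟩, hlr⟩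
  obtain ⟨k, hk1, hk2, hk3, hk4⟩ := h.exists_first_beyond hS (S.ray m) (hm.1.trans hmle)
  have hnk : n < k := by
    rcases lt_trichotomy n k with hnk | hnk | hnk
    · exact hnk
    · exact absurd (by rw [hnk, hk1]) hne
    · exact absurd hk2 (not_lt.2 (hbefore k hnk hk1))
  refine ⟨k, ⟨hnk, by rw [hk1]; exact hne.symm, hn, (hm.1.trans hmle).trans hk2.le,
    fun l hl hlr => (hk3 l hl (hlr.trans hk1)).trans hk2.le⟩, hk4.trans ?_⟩
  have hstep := step_le_prefixCost_sub hα hβ₁ hβ₂ hS.1 hmi hin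
  have hd : S.dist i ≤
      (S.prefixCost C n - S.prefixCost C m - (C.β₁ + C.β₂)) / (C.α₁ + C.α₂) := by
    rw [le_div_iff₀ hα]; linarith
  calc K * S.dist i ≤ K * ((S.prefixCost C n - S.prefixCost C m - (C.β₁ + C.β₂))
        / (C.α₁ + C.α₂)) := mul_le_mul_of_nonneg_left hd hK
    _ = _ := by ring

/-- If consecutive values of `U = prefixCost + E` along advancing pairs satisfy
`U'' ≤ κ (U' - U)`, and the map `ρ ↦ κ (1 - 1 / ρ)` decreases every `ρ ≤ ρ₀` by at least `δ > 0`,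
then no advancing pair has `U' ≤ ρ₀ U`. -/
theorem false_of_ratio_decreasing {C : CostModel} {lam : ℝ} {S : SearchStrategy}
    {E κ δ ρ₀ : ℝ} (hδ : 0 < δ) (hκ : 0 ≤ κ)
    (hpos : ∀ m n, S.AdvancePair lam m n → 0 < S.prefixCost C n + E)
    (hnext : ∀ m n, S.AdvancePair lam m n → ∃ k, S.AdvancePair lam n k ∧
      S.prefixCost C k + E ≤ κ * ((S.prefixCost C n + E) - (S.prefixCost C m + E)))
    (hmap : ∀ ρ, 0 < ρ → ρ ≤ ρ₀ → κ * (ρ - 1) ≤ (ρ - δ) * ρ)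
    {m n : ℕ} (hmn : S.AdvancePair lam m n) (hm : 0 < S.prefixCost C m + E)
    (hρ : S.prefixCost C n + E ≤ ρ₀ * (S.prefixCost C m + E)) : False := by
  have key : ∀ t : ℕ, ∃ m n, S.AdvancePair lam m n ∧ 0 < S.prefixCost C m + E ∧
      S.prefixCost C n + E ≤ (ρ₀ - t * δ) * (S.prefixCost C m + E) := by
    intro t
    induction t with
    | zero => exact ⟨m, n, hmn, hm, by simpa using hρ⟩
    | succ t ih =>
      obtain ⟨m, n, hmn, hm, hle⟩ := ih
      obtain ⟨k, hnk, hk⟩ := hnext m n hmn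
      have hn := hpos m n hmn
      refine ⟨n, k, hnk, hn, ?_⟩
      -- Positivity of the later cost keeps the ratio bound positive, so `hmap` applies.
      have hρpos : 0 < ρ₀ - t * δ := pos_of_mul_pos_left (hn.trans_le hle) hm.le
      have htδ : 0 ≤ (t : ℝ) * δ := by positivity
      have hmap' := hmap _ hρpos (by linarith)
      push_cast
      have heq : ρ₀ - ((t : ℝ) + 1) * δ = (ρ₀ - t * δ) - δ := by ring
      rw [heq]
      generalize ρ₀ - t * δ = ρ at *
      generalize S.prefixCost C m + E = u at *
      generalize S.prefixCost C n + E = v at *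
      generalize S.prefixCost C k + E = w at *
      refine le_of_mul_le_mul_left ?_ hρpos
      calc ρ * w ≤ ρ * (κ * (v - u)) := mul_le_mul_of_nonneg_left hk hρpos.le
        _ = κ * (ρ * v - ρ * u) := by ring
        _ ≤ κ * (ρ * v - v) := mul_le_mul_of_nonneg_left (by linarith) hκ
        _ = κ * (ρ - 1) * v := by ring
        _ ≤ (ρ - δ) * ρ * v := mul_le_mul_of_nonneg_right hmap' hn.le
        _ = ρ * ((ρ - δ) * v) := by ring
  obtain ⟨t, ht⟩ := exists_nat_gt (ρ₀ / δ)
  rw [div_lt_iff₀ hδ] at ht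
  obtain ⟨m, n, hmn, hm, hle⟩ := key t
  have hn := hpos m n hmn
  have := mul_neg_of_neg_of_pos (by linarith : ρ₀ - t * δ < 0) hm
  linarith

/-! ### Lower bounds in the two regimes -/

section LowerBound

variable {C : CostModel} {lam : ℝ} {S : SearchStrategy} {K : ℝ}

theorem AdvancePair.prefixCost_pos (hlam : 0 < lam) (hα : 0 < C.α₁ + C.α₂) (hβ₁ : 0 ≤ C.β₁)
    (hβ₂ : 0 ≤ C.β₂) (hS : S.IsValid) {m n : ℕ} (hmn : S.AdvancePair lam m n) :
    0 < S.prefixCost C n := by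
  have hstep := step_le_prefixCost_sub hα hβ₁ hβ₂ hS.1 (Nat.zero_le m) hmn.1
  rw [prefixCost_zero] at hstep
  have := mul_pos hα (hlam.trans_le hmn.2.2.1.1)
  linarith

theorem CostBound.pos (hlam : 0 < lam) (hα : 0 < C.α₁ + C.α₂) (hβ₁ : 0 ≤ C.β₁) (hβ₂ : 0 ≤ C.β₂)
    (h : CostBound C lam S K) (hS : S.IsValid) : 0 < K := by
  obtain ⟨m, n, hmn, hle⟩ := h.exists_advancePair hS
  have := hmn.prefixCost_pos hlam hα hβ₁ hβ₂ hS
  exact pos_of_mul_pos_left (by linarith : 0 < K * lam) hlam.le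

/-- The recurrence of `AdvancePair.exists_next`, made homogeneous by a shift. -/
theorem AdvancePair.exists_next_shifted (hα : 0 < C.α₁ + C.α₂) (hβ₁ : 0 ≤ C.β₁)
    (hβ₂ : 0 ≤ C.β₂) {κ : ℝ} (hκ : 0 ≤ κ) (h : CostBound C lam S (κ * (C.α₁ + C.α₂)))
    (hS : S.IsValid) {m n : ℕ} (hmn : S.AdvancePair lam m n) :
    ∃ k, S.AdvancePair lam n k ∧ S.prefixCost C k + (C.β₁ + κ * (C.β₁ + C.β₂)) ≤
      κ * ((S.prefixCost C n + (C.β₁ + κ * (C.β₁ + C.β₂)))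
        - (S.prefixCost C m + (C.β₁ + κ * (C.β₁ + C.β₂)))) := by
  obtain ⟨k, hk, hle⟩ := hmn.exists_next hα hβ₁ hβ₂ h (by positivity) hS
  rw [mul_div_cancel_right₀ _ hα.ne'] at hle
  exact ⟨k, hk, by linarith⟩

theorem not_costBound_of_lt_four (hlam : 0 < lam) (hα : 0 < C.α₁ + C.α₂) (hβ₁ : 0 ≤ C.β₁)
    (hβ₂ : 0 ≤ C.β₂) (hS : S.IsValid) {κ : ℝ} (hκ4 : κ < 4) :
    ¬ CostBound C lam S (κ * (C.α₁ + C.α₂)) := by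
  intro h
  have hκ : 0 < κ := pos_of_mul_pos_left (h.pos hlam hα hβ₁ hβ₂ hS) hα.le
  have hE : 0 ≤ C.β₁ + κ * (C.β₁ + C.β₂) := by positivity
  have hpos : ∀ m n, S.AdvancePair lam m n →
      0 < S.prefixCost C n + (C.β₁ + κ * (C.β₁ + C.β₂)) := fun m n hmn =>
    add_pos_of_pos_of_nonneg (hmn.prefixCost_pos hlam hα hβ₁ hβ₂ hS) hE
  obtain ⟨m, n, hmn, -⟩ := h.exists_advancePair hS
  -- The descent starts from the second pair: if `m = 0` and the constant costs vanish, the shifted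
  -- cost at `m` is 0.
  obtain ⟨k, hnk, -⟩ := hmn.exists_next_shifted hα hβ₁ hβ₂ hκ.le h hS
  have hsq := Real.sq_sqrt hκ.le
  have hs : 0 < √κ := Real.sqrt_pos.2 hκ
  have hs2 : √κ < 2 := by nlinarith
  -- By AM-GM, `ρ + κ / ρ - κ ≥ 2 * √κ - κ`, positive because `κ < 4`.
  refine false_of_ratio_decreasing (δ := 2 * √κ - κ)
    (ρ₀ := (S.prefixCost C k + (C.β₁ + κ * (C.β₁ + C.β₂)))
      / (S.prefixCost C n + (C.β₁ + κ * (C.β₁ + C.β₂)))) (by nlinarith) hκ.le hpos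
    (fun m n hmn => hmn.exists_next_shifted hα hβ₁ hβ₂ hκ.le h hS) (fun ρ _ _ => ?_) hnk
    (hpos m n hmn) (div_mul_cancel₀ _ (hpos m n hmn).ne').ge
  nlinarith [sq_nonneg (ρ - √κ)]

/-- `Φ` is the smaller fixed point of `ρ ↦ κ' (1 - 1 / ρ)` for `κ' = Φ ^ 2 / (Φ - 1)`, as `Φ ≤ 2`.
The hypothesis `hΦ` says that at `κ'` the bound on the initial ratio, with no cost before `m`, is
exactly `Φ`. -/
theorem not_costBound_of_lt {Φ : ℝ} (hlam : 0 < lam) (hα : 0 < C.α₁ + C.α₂)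
    (hβ₁ : 0 ≤ C.β₁) (hβ₂ : 0 ≤ C.β₂) (hβ : 0 < C.β₁ + C.β₂) (hS : S.IsValid)
    (hΦ1 : 1 < Φ) (hΦ2 : Φ ≤ 2)
    (hΦ : Φ ^ 2 / (Φ - 1) * ((C.α₁ + C.α₂) * lam + (C.β₁ + C.β₂))
      = Φ * (C.β₁ + Φ ^ 2 / (Φ - 1) * (C.β₁ + C.β₂)))
    {κ : ℝ} (hκΦ : κ < Φ ^ 2 / (Φ - 1)) :
    ¬ CostBound C lam S (κ * (C.α₁ + C.α₂)) := by
  intro h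
  have hκ : 0 < κ := pos_of_mul_pos_left (h.pos hlam hα hβ₁ hβ₂ hS) hα.le
  have hΦ0 : 0 < Φ := by linarith
  have hΦ1' : 0 < Φ - 1 := by linarith
  have hκ' : Φ ^ 2 / (Φ - 1) * (Φ - 1) = Φ ^ 2 := div_mul_cancel₀ _ hΦ1'.ne'
  generalize Φ ^ 2 / (Φ - 1) = κ' at *
  have hE : 0 < C.β₁ + κ * (C.β₁ + C.β₂) := by positivity
  have hpos : ∀ n, 0 < S.prefixCost C n + (C.β₁ + κ * (C.β₁ + C.β₂)) := fun n => by
    have := prefixCost_mono hα hβ₁ hβ₂ hS.1 (Nat.zero_le n)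
    rw [prefixCost_zero] at this
    linarith
  obtain ⟨m, n, hmn, hfound⟩ := h.exists_advancePair hS
  obtain ⟨k, hnk, hk⟩ := hmn.exists_next_shifted hα hβ₁ hβ₂ hκ.le h hS
  have hm0 : 0 ≤ S.prefixCost C m := by
    have := prefixCost_mono hα hβ₁ hβ₂ hS.1 (Nat.zero_le m)
    rwa [prefixCost_zero] at this
  have hfirst : S.prefixCost C n + (C.β₁ + κ * (C.β₁ + C.β₂))
      ≤ Φ * (S.prefixCost C m + (C.β₁ + κ * (C.β₁ + C.β₂))) := by
    have h1 : κ' * ((C.α₁ + C.α₂) * lam + (C.β₁ + C.β₂) - Φ * (C.β₁ + C.β₂)) = Φ * C.β₁ := by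
      linarith
    have h2 : 0 ≤ (C.α₁ + C.α₂) * lam + (C.β₁ + C.β₂) - Φ * (C.β₁ + C.β₂) :=
      nonneg_of_mul_nonneg_right (h1 ▸ mul_nonneg hΦ0.le hβ₁) (hκ.trans hκΦ)
    have h3 := mul_le_mul_of_nonneg_right hκΦ.le h2
    have h4 := mul_nonneg hΦ0.le hm0
    linarith
  -- The first ratio might equal the fixed point `Φ`; one iteration with `κ < κ'` brings it strictly
  -- below.
  obtain ⟨ρ₁, hρ₁⟩ : ∃ ρ₁, ρ₁ = κ * (1 - 1 / Φ) := ⟨_, rfl⟩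
  have hΦinv : 0 < 1 - 1 / Φ := by
    rw [sub_pos, div_lt_one hΦ0]; exact hΦ1
  have hρ₁Φ : ρ₁ < Φ := by
    have : κ' * (1 - 1 / Φ) = Φ := by
      field_simp; linarith
    rw [hρ₁]
    exact (mul_lt_mul_of_pos_right hκΦ hΦinv).trans_eq this
  have hsecond : S.prefixCost C k + (C.β₁ + κ * (C.β₁ + C.β₂))
      ≤ ρ₁ * (S.prefixCost C n + (C.β₁ + κ * (C.β₁ + C.β₂))) := by
    refine hk.trans ?_
    rw [hρ₁, mul_assoc]
    refine mul_le_mul_of_nonneg_left ?_ hκ.le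
    rw [← div_le_iff₀' hΦ0] at hfirst
    rw [sub_mul, one_mul, one_div_mul_eq_div]
    linarith
  -- The shift keeps `κ`, but the factor may be enlarged to `κ'` since the cost differences are
  -- nonnegative.
  refine false_of_ratio_decreasing (κ := κ') (δ := (Φ - ρ₁) ^ 2 / Φ)
    (div_pos (pow_pos (by linarith) 2) hΦ0) (hκ.trans hκΦ).le (fun m n _ => hpos n)
    (fun m n hmn => ?_) (fun ρ hρ0 hρ => ?_) hnk (hpos n) hsecond
  · obtain ⟨k, hk, hle⟩ := hmn.exists_next_shifted hα hβ₁ hβ₂ hκ.le h hS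
    refine ⟨k, hk, hle.trans (mul_le_mul_of_nonneg_right hκΦ.le ?_)⟩
    have := prefixCost_mono hα hβ₁ hβ₂ hS.1 hmn.1.le
    linarith
  · have hδ : (Φ - ρ₁) ^ 2 / Φ * ρ ≤ (Φ - ρ₁) ^ 2 := by
      rw [div_mul_eq_mul_div, div_le_iff₀ hΦ0]
      exact mul_le_mul_of_nonneg_left (hρ.trans hρ₁Φ.le) (sq_nonneg _)
    -- The roots are `Φ` and `κ' - Φ ≥ Φ`, so for `ρ ≤ ρ₁` both factors are at least `Φ - ρ₁`.
    have hfac : ρ ^ 2 - κ' * ρ + κ' = (Φ - ρ) * (κ' - Φ - ρ) := by linarith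
    have hκ'2 : Φ ≤ κ' - Φ := by
      refine le_of_mul_le_mul_right ?_ hΦ1'
      nlinarith
    have : (Φ - ρ₁) * (Φ - ρ₁) ≤ (Φ - ρ) * (κ' - Φ - ρ) :=
      mul_le_mul (by linarith) (by linarith) (by linarith) (by linarith)
    linarith

end LowerBound

/-! ### Alternating strategies and the tight recurrence -/

theorem ray_two_mul {S : SearchStrategy} (hS : S.IsPeriodic) (k : ℕ) :
    S.ray (2 * k) = S.ray 0 ∧ S.ray (2 * k + 1) = S.ray 1 := by
  induction k with
  | zero => simp
  | succ k ih => exact ⟨(hS.2 _).trans ih.1, (hS.2 _).trans ih.2⟩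

theorem isValid_of_isPeriodic {S : SearchStrategy} (hS : S.IsPeriodic)
    (hnonneg : ∀ i, 0 ≤ S.dist i) (hlim : Filter.Tendsto S.dist Filter.atTop Filter.atTop) :
    S.IsValid := by
  refine ⟨hnonneg, fun r M => ?_⟩
  obtain ⟨N, hN⟩ := Filter.eventually_atTop.1 (hlim.eventually_gt_atTop M)
  have hr : r = S.ray 0 ∨ r = S.ray 1 := by
    have := hS.1
    revert this
    cases r <;> cases S.ray 0 <;> cases S.ray 1 <;> simp
  obtain rfl | rfl := hr
  · exact ⟨2 * N, (ray_two_mul hS N).1, hN _ (by omega)⟩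
  · exact ⟨2 * N + 1, (ray_two_mul hS N).2, hN _ (by omega)⟩

/-- An alternating strategy satisfying the tight recurrence attains the cost `K + α₁`. -/
theorem costBound_of_isPeriodic {C : CostModel} {lam : ℝ} {S : SearchStrategy} {K : ℝ}
    {X : ℕ → ℝ} (hK : 0 ≤ K) (hα : 0 < C.α₁ + C.α₂) (hβ₁ : 0 ≤ C.β₁) (hβ₂ : 0 ≤ C.β₂)
    (hS : S.IsPeriodic) (hv : S.IsValid) (hX : ∀ i, S.dist i = X (i + 1)) (hX0 : X 0 = lam)
    (hrec : ∀ j, S.prefixCost C (j + 1) + C.β₁ = K * X j) : CostBound C lam S K := by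
  classical
  intro r D hD
  have hex : ∃ j, S.ray j = r ∧ D ≤ S.dist j := (hv.2 r D).imp fun j hj => ⟨hj.1, hj.2.le⟩
  obtain ⟨h1, h2⟩ := Nat.find_spec hex
  have h3 : ∀ i < Nat.find hex, S.ray i = r → S.dist i < D := fun i hi hir =>
    not_le.1 fun hle => Nat.find_min hex hi ⟨hir, hle⟩
  generalize Nat.find hex = j at *
  refine ⟨j, ⟨h1, h2, h3⟩, ?_⟩
  match j with
  | 0 =>
    have hle := prefixCost_mono hα hβ₁ hβ₂ hv.1 (Nat.zero_le 1)
    have h0 := hrec 0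
    rw [hX0] at h0
    have := mul_le_mul_of_nonneg_left hD hK
    linarith
  | 1 =>
    rw [hrec 0, hX0]
    exact mul_le_mul_of_nonneg_left hD hK
  | j + 2 =>
    -- The target was missed two steps earlier, so `D` exceeds `dist j = X (j + 1)`.
    rw [hrec (j + 1), ← hX]
    exact mul_le_mul_of_nonneg_left
      (h3 j (by omega) ((hS.2 j).symm.trans h1)).le hK

theorem isOptimal_and_competitiveCost_eq {C : CostModel} {lam : ℝ} {S : SearchStrategy} {K : ℝ}
    (hlam : 0 < lam) (hv : S.IsValid) (hS : CostBound C lam S K)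
    (hlower : ∀ S' : SearchStrategy, S'.IsValid → ∀ K' < K, ¬ CostBound C lam S' K') :
    S.IsOptimal C lam ∧ S.competitiveCost C lam = ((K + C.α₁ : ℝ) : EReal) := by
  have hle := competitiveCost_le_of_costBound hlam hS
  have hge : ∀ S' : SearchStrategy, S'.IsValid →
      ((K + C.α₁ : ℝ) : EReal) ≤ S'.competitiveCost C lam := fun S' hS' =>
    not_lt.1 fun hlt =>
      let ⟨K', hK', hb⟩ := exists_costBound_of_competitiveCost_lt hlam hlt
      hlower S' hS' K' hK' hb
  exact ⟨⟨hv, fun S' hS' => hle.trans (hge S' hS')⟩, le_antisymm hle (hge S hv)⟩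

/-- The tight recurrence follows from its first instance and its differences. -/
theorem prefixCost_succ_add_eq {C : CostModel} {S : SearchStrategy} {K : ℝ} {X : ℕ → ℝ}
    (hX : ∀ i, S.dist i = X (i + 1))
    (h0 : (C.α₁ + C.α₂) * X 1 + (C.β₁ + C.β₂) + C.β₁ = K * X 0)
    (hstep : ∀ j, (C.α₁ + C.α₂) * X (j + 2) + (C.β₁ + C.β₂) = K * (X (j + 1) - X j)) (j : ℕ) :
    S.prefixCost C (j + 1) + C.β₁ = K * X j := by
  induction j with
  | zero => rw [prefixCost_succ, prefixCost_zero, hX]; linarith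
  | succ j ih =>
    rw [prefixCost_succ, hX]
    have := hstep j
    linarith

end SearchStrategy

/-! ### The two explicit strategies -/

namespace CostModel

open SearchStrategy

variable {C : CostModel} {lam : ℝ}

theorem offset_nonneg (hlam : 0 < lam) (hα : 0 < C.α₁ + C.α₂) (hβ₁ : 0 ≤ C.β₁)
    (hβ₂ : 0 ≤ C.β₂) : 0 ≤ C.offset lam := by
  unfold offset; positivity

theorem mul_offset (hlam : 0 < lam) (hα : 0 < C.α₁ + C.α₂) :
    (C.α₁ + C.α₂) * (C.offset lam * lam) = C.β₁ + C.β₂ := by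
  unfold offset; field_simp

theorem mul_threshold (hlam : 0 < lam) (hα : 0 < C.α₁ + C.α₂) :
    2 * ((C.α₁ + C.α₂) * (C.threshold lam * lam)) = 3 * C.β₁ + 2 * C.β₂ := by
  unfold threshold; field_simp

/-- The threshold condition makes the coefficient of `i` nonnegative. -/
theorem xSmall_ge (hlam : 0 < lam) (ho : 0 ≤ C.offset lam) (ht : C.threshold lam ≤ 1) (i : ℕ) :
    2 ^ i * lam ≤ C.xSmall lam i := by
  unfold xSmall
  refine mul_le_mul_of_nonneg_right ?_ hlam.le
  have h1 : (1 : ℝ) ≤ 2 ^ i := one_le_pow₀ (by norm_num)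
  have h2 : 0 ≤ (1 - C.threshold lam) * (i : ℝ) * 2 ^ i :=
    mul_nonneg (mul_nonneg (by linarith) (Nat.cast_nonneg i)) (by positivity)
  have h3 := mul_le_mul_of_nonneg_left h1 ho
  linarith

theorem xLarge_ge (hlam : 0 < lam) (ho : 0 ≤ C.offset lam) (hΦ : 1 ≤ C.Phi lam) (i : ℕ) :
    C.Phi lam ^ i * lam ≤ C.xLarge lam i := by
  unfold xLarge
  refine mul_le_mul_of_nonneg_right ?_ hlam.le
  have h3 := mul_le_mul_of_nonneg_left (one_le_pow₀ hΦ (n := i)) ho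
  linarith

/-- A sequence that dominates a geometric sequence gives a valid alternating strategy. -/
theorem isValid_of_geometric_le {S : SearchStrategy} (hS : S.IsPeriodic) (hlam : 0 < lam)
    {X : ℕ → ℝ} (hX : ∀ i, S.dist i = X (i + 1)) {q : ℝ} (hq : 1 < q)
    (hge : ∀ i, q ^ i * lam ≤ X i) : S.IsValid := by
  refine isValid_of_isPeriodic hS (fun i => ?_) ?_
  · rw [hX]
    exact le_trans (by positivity) (hge (i + 1))
  · refine Filter.tendsto_atTop_mono (fun i => (hge (i + 1)).trans (hX i).ge) ?_
    exact ((tendsto_pow_atTop_atTop_of_one_lt hq).comp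
      (Filter.tendsto_add_atTop_nat 1)).atTop_mul_const hlam

theorem xSmall_isOptimal (hlam : 0 < lam) (hα : 0 < C.α₁ + C.α₂) (hβ₁ : 0 ≤ C.β₁)
    (hβ₂ : 0 ≤ C.β₂) (ht : C.threshold lam ≤ 1) {S : SearchStrategy} (hS : S.IsPeriodic)
    (hX : ∀ i, S.dist i = C.xSmall lam (i + 1)) :
    S.IsOptimal C lam ∧
      S.competitiveCost C lam = ((5 * C.α₁ + 4 * C.α₂ : ℝ) : EReal) := by
  have ho := offset_nonneg hlam hα hβ₁ hβ₂
  have hmo := mul_offset hlam hα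
  have hmt := mul_threshold hlam hα
  have hv : S.IsValid :=
    isValid_of_geometric_le hS hlam hX one_lt_two (xSmall_ge hlam ho ht)
  have hb : CostBound C lam S (4 * (C.α₁ + C.α₂)) := by
    refine costBound_of_isPeriodic (by positivity) hα hβ₁ hβ₂ hS hv hX (by simp [xSmall])
      (prefixCost_succ_add_eq hX ?_ fun j => ?_)
    · simp only [xSmall]
      push_cast
      linear_combination hmo - hmt
    · simp only [xSmall]
      push_cast
      linear_combination -hmo
  have hl := isOptimal_and_competitiveCost_eq hlam hv hb fun S' hS' K' hK' => by
    have := not_costBound_of_lt_four hlam hα hβ₁ hβ₂ hS' ((div_lt_iff₀ hα).2 hK')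
    rwa [div_mul_cancel₀ _ hα.ne'] at this
  convert hl using 3
  ring

/-- `Φ = 1 + 1 / s`, where `s ≥ 1` is the positive root of a quadratic equation. -/
theorem exists_Phi_eq (hlam : 0 < lam) (hα : 0 < C.α₁ + C.α₂) (hβ₁ : 0 ≤ C.β₁)
    (hβ₂ : 0 ≤ C.β₂) (ht : 1 ≤ C.threshold lam) :
    ∃ s, 1 ≤ s ∧ C.Phi lam = 1 + s⁻¹ ∧
      (C.α₁ + C.α₂) * lam * s ^ 2
        + ((C.α₁ + C.α₂) * lam - (C.β₁ + C.β₂) - C.β₁) * s - (C.β₁ + C.β₂) = 0 := by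
  refine ⟨_, ?_, rfl, ?_⟩
  all_goals
    have hmt := mul_threshold hlam hα
    have hL : 0 < (C.α₁ + C.α₂) * lam := mul_pos hα hlam
    have ht' : 2 * ((C.α₁ + C.α₂) * lam) ≤ 3 * C.β₁ + 2 * C.β₂ := by
      have := mul_le_mul_of_nonneg_right ht hL.le
      linarith
    rw [mul_assoc 2 (C.α₁ + C.α₂) lam]
    clear ht hmt
    generalize (C.α₁ + C.α₂) * lam = L at *
  · rw [le_div_iff₀ (by positivity), one_mul]
    -- This is `s ≥ 1`, that is `Φ ≤ 2`; squared, it reduces to the threshold condition `ht'`.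
    have : 3 * L - 2 * C.β₁ - C.β₂ ≤
        √((2 * C.β₁ + C.β₂) ^ 2 - C.β₂ ^ 2 + (C.β₂ + L) ^ 2) := by
      apply Real.le_sqrt_of_sq_le
      nlinarith
    linarith
  · have hsq := Real.sq_sqrt (x := (2 * C.β₁ + C.β₂) ^ 2 - C.β₂ ^ 2 + (C.β₂ + L) ^ 2)
      (by nlinarith [mul_nonneg hβ₁ hβ₂, sq_nonneg (C.β₂ + L)])
    generalize √((2 * C.β₁ + C.β₂) ^ 2 - C.β₂ ^ 2 + (C.β₂ + L) ^ 2) = R at *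
    field_simp
    linear_combination hsq

theorem xLarge_isOptimal (hlam : 0 < lam) (hα : 0 < C.α₁ + C.α₂) (hβ₁ : 0 ≤ C.β₁)
    (hβ₂ : 0 ≤ C.β₂) (ht : 1 ≤ C.threshold lam) {S : SearchStrategy} (hS : S.IsPeriodic)
    (hX : ∀ i, S.dist i = C.xLarge lam (i + 1)) :
    S.IsOptimal C lam ∧
      S.competitiveCost C lam =
        ((((C.α₁ + C.α₂) * C.xLarge lam 1 + (C.β₁ + C.β₂) + (C.α₁ * lam + C.β₁)) / lam : ℝ)
          : EReal) := by
  obtain ⟨s, hs1, hΦ, hquad⟩ := exists_Phi_eq hlam hα hβ₁ hβ₂ ht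
  have hs : 0 < s := by linarith
  have ho := offset_nonneg hlam hα hβ₁ hβ₂
  have hmo := mul_offset hlam hα
  have hL : 0 < (C.α₁ + C.α₂) * lam := mul_pos hα hlam
  have hβ : 0 < C.β₁ + C.β₂ := by
    have := mul_threshold hlam hα
    have := mul_le_mul_of_nonneg_right ht hL.le
    linarith
  have hΦ1 : 1 < C.Phi lam := by rw [hΦ]; linarith [inv_pos.2 hs]
  have hΦ2 : C.Phi lam ≤ 2 := by rw [hΦ]; linarith [inv_le_one_of_one_le₀ hs1]
  have hΦ1' : 0 < C.Phi lam - 1 := by linarith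
  have hv : S.IsValid := isValid_of_geometric_le hS hlam hX hΦ1 (xLarge_ge hlam ho hΦ1.le)
  have hκ : C.Phi lam ^ 2 / (C.Phi lam - 1) = (s + 1) ^ 2 / s := by
    rw [hΦ]; field_simp; ring
  -- The quadratic for `s` is what makes the purely geometric solution match the initial condition.
  have h0 : (C.α₁ + C.α₂) * C.xLarge lam 1 + (C.β₁ + C.β₂) + C.β₁
      = C.Phi lam ^ 2 / (C.Phi lam - 1) * (C.α₁ + C.α₂) * C.xLarge lam 0 := by
    have h1 : (C.α₁ + C.α₂) * C.xLarge lam 1 + (C.β₁ + C.β₂)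
        = ((C.α₁ + C.α₂) * lam + (C.β₁ + C.β₂)) * C.Phi lam := by
      simp only [xLarge]
      linear_combination (C.Phi lam - 1) * hmo
    have h2 : C.xLarge lam 0 = lam := by simp [xLarge]
    rw [h1, h2, hκ, hΦ]
    field_simp
    linear_combination -hquad
  have hb : CostBound C lam S (C.Phi lam ^ 2 / (C.Phi lam - 1) * (C.α₁ + C.α₂)) := by
    refine costBound_of_isPeriodic (by positivity) hα hβ₁ hβ₂ hS hv hX (by simp [xLarge])
      (prefixCost_succ_add_eq hX h0 fun j => ?_)
    simp only [xLarge]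
    have h1 : C.Phi lam ^ 2 / (C.Phi lam - 1) * (C.Phi lam - 1) = C.Phi lam ^ 2 :=
      div_mul_cancel₀ _ hΦ1'.ne'
    linear_combination -hmo
      - (C.α₁ + C.α₂) * (1 + C.offset lam) * C.Phi lam ^ j * lam * h1
  have hPhi : C.Phi lam ^ 2 / (C.Phi lam - 1) * ((C.α₁ + C.α₂) * lam + (C.β₁ + C.β₂))
      = C.Phi lam * (C.β₁ + C.Phi lam ^ 2 / (C.Phi lam - 1) * (C.β₁ + C.β₂)) := by
    rw [hκ, hΦ]
    field_simp
    linear_combination hquad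
  have hl := isOptimal_and_competitiveCost_eq hlam hv hb fun S' hS' K' hK' => by
    have := not_costBound_of_lt hlam hα hβ₁ hβ₂ hβ hS' hΦ1 hΦ2 hPhi ((div_lt_iff₀ hα).2 hK')
    rwa [div_mul_cancel₀ _ hα.ne'] at this
  convert hl using 3
  rw [div_eq_iff hlam.ne']
  have h2 : C.xLarge lam 0 = lam := by simp [xLarge]
  rw [h2] at h0
  linarith

end CostModel

theorem theorem5 (C : CostModel) (lam : ℝ) (hlam : 0 < lam)
    (hα₁ : 0 ≤ C.α₁) (hα₂ : 0 ≤ C.α₂) (hα : 0 < C.α₁ + C.α₂)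
    (hβ₁ : 0 ≤ C.β₁) (hβ₂ : 0 ≤ C.β₂) :
    (C.threshold lam ≤ 1 →
      ∀ S : SearchStrategy, S.IsPeriodic → (∀ i, S.dist i = C.xSmall lam (i + 1)) →
        S.IsOptimal C lam ∧
        S.competitiveCost C lam = ((5 * C.α₁ + 4 * C.α₂ : ℝ) : EReal)) ∧
    (1 ≤ C.threshold lam →
      ∀ S : SearchStrategy, S.IsPeriodic → (∀ i, S.dist i = C.xLarge lam (i + 1)) →
        S.IsOptimal C lam ∧
        S.competitiveCost C lam =
          ((((C.α₁ + C.α₂) * C.xLarge lam 1 + (C.β₁ + C.β₂) + (C.α₁ * lam + C.β₁)) / lam : ℝ)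
            : EReal)) := by
  exact ⟨fun ht _ hS hX => CostModel.xSmall_isOptimal hlam hα hβ₁ hβ₂ ht hS hX,
    fun ht _ hS hX => CostModel.xLarge_isOptimal hlam hα hβ₁ hβ₂ ht hS hX⟩
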